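/- Let $\pi : Y \to X$ be a fibered manifold (a smooth surjective submersion of smooth manifolds) with $\dim X = n$ and $\dim Y = n+m$. Let $W \subset Y$ be open, let $W^q = J^qW$ denote the $q$-jet prolongation of $W$, and let $\pi^q : W^q \to X$ and $\pi^{q,p} : W^q \to W^p$ ($q \ge p$) be the projections. Let $\Omega_k(W^q)$ be the real vector space of smooth $k$-forms on $W^q$. For $\rho \in \Omega_k(W^q)$ let $h\rho$ and $p_1\rho$, both in $\Omega_k(W^{q+1})$, denote the horizontal part and the $1$-contact part of $\rho$. A Lagrangian of order $r$ is a $\pi^r$-horizontal $n$-form on $W^r$; these form the real vector space $\Omega_{n,X}(W^r)$. In a fibered chart $(x^i, y^\sigma)$, with induced jet coordinates $y^\sigma_J$, one has $\lambda = \mathcal L\,\omega_0$ with $\omega_0 = dx^1\wedge\dots\wedge dx^n$, and the Euler–Lagrange form of $\lambda$ is $$\mathcal E_\lambda = \mathcal E_\sigma(\lambda)\, \omega^\sigma \wedge \omega_0, \qquad \mathcal E_\sigma(\lambda) = \sum_{|J| \le r} (-1)^{|J|} d_J \frac{\partial \mathcal L}{\partial y^\sigma_J}, \qquad \omega^\sigma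 = dy^\sigma - y^\sigma_j\,dx^j,$$ where the sum runs over unordered multi-indices $J$ and $d_J$ is the iterated total derivative. A Lagrangian $\lambda$ is called trivial if $\mathcal E_\lambda = 0$, and two Lagrangians $\lambda, \lambda'$ of order $r$ are called dynamically equivalent if $\mathcal E_\lambda = \mathcal E_{\lambda'}$. A Lepage equivalent of order $s$ of $\lambda \in \Omega_{n,X}(W^r)$ is a form $\theta \in \Omega_n(W^s)$ such that $h\theta = \lambda$ (up to pullback by jet projections) and $p_1 d\theta$ is a source form, i.e. a $1$-contact, $\pi^{s+1,0}$-horizontal $(n+1)$-form. Let $r, s \ge 0$ be integers and let $\lambda \mapsto \theta_\lambda$ be a mapping $\Omega_{n,X}(W^r) \to \Omega_n(W^s)$ that attaches to each Lagrangian a Lepage equivalent of it. Suppose that this mapping is $\mathbb R$-linear and has the closure property: $d\theta_\lambda = 0$ for every trivial $\lambda \in \Omega_{n,X}(W^r)$. Then, for any two dynamically equivalent Lagrangians $\lambda, \lambda' \in \Omega_{n,X}(W^r)$, $$d\theta_\lambda = d\theta_{\lambda'}.$$ -/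

import Mathlib

open scoped Manifold ContDiff

noncomputable section

namespace Lepage

/-! ## Coordinates on jet spaces -/

/-- Multi-indices of length at most `r` in `n` variables: unordered index tuples
`j₁ … j_k`, `0 ≤ k ≤ r`. -/
abbrev MultiIndex (n r : ℕ) : Type := Σ k : Fin (r + 1), Sym (Fin n) k

/-- The coordinate space of `r`-jets: points `(x^i, y^σ_J)`, where `J` runs over the
multi-indices of length at most `r`. -/
abbrev JetCoord (n m r : ℕ) : Type :=
  EuclideanSpace ℝ (Fin n) × (MultiIndex n r → EuclideanSpace ℝ (Fin m))

/-- The empty multi-index. -/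
def MultiIndex.empty (n r : ℕ) : MultiIndex n r := ⟨0, Sym.nil⟩

/-- The multi-index `J i`, of length one more. -/
def MultiIndex.cons {n r : ℕ} (i : Fin n) (J : MultiIndex n r) : MultiIndex n (r + 1) :=
  ⟨J.1.succ, i ::ₛ J.2⟩

/-- A multi-index of length at most `r`, regarded as one of length at most `s`. -/
def MultiIndex.lift {n r s : ℕ} (h : r ≤ s) (J : MultiIndex n r) : MultiIndex n s :=
  ⟨Fin.castLE (Nat.succ_le_succ h) J.1, J.2⟩

/-- An enumeration of the entries of a multi-index (the order will not matter). -/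
def MultiIndex.toList {n r : ℕ} (J : MultiIndex n r) : List (Fin n) :=
  (J.2 : Multiset (Fin n)).toList

theorem MultiIndex.length_toList_le {n r : ℕ} (J : MultiIndex n r) : J.toList.length ≤ r := by
  have h : J.toList.length = (J.1 : ℕ) := by simp [MultiIndex.toList]
  have := J.1.isLt
  omega

/-- The jet projection `π^{s,r}` in coordinates (a linear map). -/
def jetProj (n m : ℕ) {r s : ℕ} (h : r ≤ s) : JetCoord n m s →L[ℝ] JetCoord n m r :=
  (ContinuousLinearMap.fst ℝ _ _).prod
    (ContinuousLinearMap.pi fun J =>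
      (ContinuousLinearMap.proj (J.lift h)).comp (ContinuousLinearMap.snd ℝ _ _))

/-- The coordinates `(x^i, y^σ)` of the target of a jet. -/
def targetCoord {n m r : ℕ} (z : JetCoord n m r) :
    EuclideanSpace ℝ (Fin n) × EuclideanSpace ℝ (Fin m) :=
  (z.1, z.2 (MultiIndex.empty n r))

/-- The total derivative direction
`∂/∂x^i + ∑_{|J| ≤ r} y^σ_{J i} ∂/∂y^σ_J` on `r`-jets, at the `(r+1)`-jet `z`. -/
def totalVec {n m r : ℕ} (z : JetCoord n m (r + 1)) (i : Fin n) : JetCoord n m r :=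
  (EuclideanSpace.single i 1, fun J => z.2 (J.cons i))

/-- The total derivative `d_i f`, a function of order `r + 1`, of a function `f` of order `r`. -/
def totalDeriv {n m r : ℕ} (i : Fin n) (f : JetCoord n m r → ℝ) : JetCoord n m (r + 1) → ℝ :=
  fun z => fderiv ℝ f (jetProj n m (Nat.le_succ r) z) (totalVec z i)

/-- Iterated total derivatives `d_{i₁} … d_{i_k} f`. -/
def iterTotalDeriv {n m r : ℕ} (f : JetCoord n m r → ℝ) :
    (l : List (Fin n)) → JetCoord n m (r + l.length) → ℝ
  | [] => f
  | i :: l => totalDeriv i (iterTotalDeriv f l)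

/-- The partial derivative `∂f/∂y^σ_J`. -/
def partialY {n m r : ℕ} (σ : Fin m) (J : MultiIndex n r) (f : JetCoord n m r → ℝ) :
    JetCoord n m r → ℝ :=
  fun z => fderiv ℝ f z (0, Pi.single J (EuclideanSpace.single σ 1))

/-- The Euler–Lagrange expressions
`E_σ = ∑_{|J| ≤ r} (-1)^{|J|} d_J (∂L/∂y^σ_J)` of a Lagrange function `L` of order `r`;
the sum runs over unordered multi-indices. -/
def eulerExpr {n m r : ℕ} (L : JetCoord n m r → ℝ) (σ : Fin m) : JetCoord n m (2 * r) → ℝ :=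
  fun z => ∑ J : MultiIndex n r, (-1 : ℝ) ^ (J.1 : ℕ) *
    iterTotalDeriv (partialY σ J L) J.toList
      (jetProj n m (by have := J.length_toList_le; omega) z)

/-- The horizontal projection of tangent vectors at an `(r+1)`-jet `z`:
`v ↦ ∑ᵢ v^i (∂/∂x^i + ∑ y^σ_{J i} ∂/∂y^σ_J)`. Composition with it replaces `dx^i` by `dx^i` and
`dy^σ_J` by `y^σ_{J i} dx^i`. -/
def horMap {n m r : ℕ} (z : JetCoord n m (r + 1)) : JetCoord n m (r + 1) →L[ℝ] JetCoord n m r :=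
  ∑ i : Fin n, ((EuclideanSpace.proj i).comp (ContinuousLinearMap.fst ℝ _ _)).smulRight
    (totalVec z i)

/-- The complementary projection of tangent vectors at an `(r+1)`-jet `z`. Composition with it
replaces `dx^i` by `0` and `dy^σ_J` by the contact form `dy^σ_J - y^σ_{J i} dx^i`. -/
def conMap {n m r : ℕ} (z : JetCoord n m (r + 1)) : JetCoord n m (r + 1) →L[ℝ] JetCoord n m r :=
  jetProj n m (Nat.le_succ r) - horMap z

/-- For an alternating form `A` and linear maps `H`, `C`, the alternating form
`v ↦ ∑ₐ A (H v₁, …, C vₐ, …, H v_k)`. -/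
def onePart {E F : Type*} [NormedAddCommGroup E] [NormedSpace ℝ E] [NormedAddCommGroup F]
    [NormedSpace ℝ F] {k : ℕ} (A : E [⋀^Fin k]→L[ℝ] ℝ) (H C : F →L[ℝ] E) :
    F [⋀^Fin k]→L[ℝ] ℝ where
  toContinuousMultilinearMap := ∑ a : Fin k,
    A.toContinuousMultilinearMap.compContinuousLinearMap (Function.update (fun _ => H) a C)
  map_eq_zero_of_eq' := by
    intro v i j hv hij
    have key : ∀ a : Fin k,
        A (fun b => (Function.update (fun _ => H) a C b) (v b)) +
        A (fun b => (Function.update (fun _ => H) (Equiv.swap i j a) C b) (v b)) = 0 := by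
      intro a
      have h1 : (fun b => (Function.update (fun _ => H) (Equiv.swap i j a) C b) (v b)) =
          (fun b => (Function.update (fun _ => H) a C b) (v b)) ∘ Equiv.swap i j := by
        funext b
        have hvb : v (Equiv.swap i j b) = v b := by
          rcases eq_or_ne b i with rfl | hbi
          · rw [Equiv.swap_apply_left, hv]
          · rcases eq_or_ne b j with rfl | hbj
            · rw [Equiv.swap_apply_right, hv]
            · rw [Equiv.swap_apply_of_ne_of_ne hbi hbj]
        have hab : Equiv.swap i j b = a ↔ b = Equiv.swap i j a := by
          constructor
          · rintro rfl; simp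
          · rintro rfl; simp
        simp only [Function.comp_apply, hvb, Function.update_apply, hab]
      rw [h1]
      have h2 := A.toAlternatingMap.map_swap
        (fun b => (Function.update (fun _ => H) a C b) (v b)) hij
      change A _ = -A _ at h2
      rw [h2, add_neg_cancel]
    change (∑ a : Fin k, A.toContinuousMultilinearMap.compContinuousLinearMap
      (Function.update (fun _ => H) a C)) v = 0
    rw [sum_apply]
    refine Finset.sum_involution (fun a _ => Equiv.swap i j a) (fun a _ => key a) ?_
      (fun a _ => Finset.mem_univ _) (fun a _ => by simp)
    intro a _ ha heq
    have h2 := key a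
    rw [heq] at h2
    exact ha (by
      change A (fun b => (Function.update (fun _ => H) a C b) (v b)) = 0
      linarith)

/-- The determinant as a continuous alternating form. -/
def detForm (k : ℕ) : (Fin k → ℝ) [⋀^Fin k]→L[ℝ] ℝ where
  toMultilinearMap := (Matrix.detRowAlternating : (Fin k → ℝ) [⋀^Fin k]→ₗ[ℝ] ℝ).toMultilinearMap
  cont := by
    change Continuous fun M : Matrix (Fin k) (Fin k) ℝ => M.det
    fun_prop
  map_eq_zero_of_eq' := (Matrix.detRowAlternating : (Fin k → ℝ) [⋀^Fin k]→ₗ[ℝ] ℝ).map_eq_zero_of_eq'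

/-- The wedge product of one-forms, `(α₁ ∧ … ∧ α_k)(v₁, …, v_k) = det (α_j (v_i))`. -/
def wedge {E : Type*} [NormedAddCommGroup E] [NormedSpace ℝ E] {k : ℕ}
    (α : Fin k → E →L[ℝ] ℝ) : E [⋀^Fin k]→L[ℝ] ℝ :=
  (detForm k).compContinuousLinearMap (ContinuousLinearMap.pi α)

/-- The coordinate one-form `dx^i`. -/
def dx {n m : ℕ} (r : ℕ) (i : Fin n) : JetCoord n m r →L[ℝ] ℝ :=
  (EuclideanSpace.proj i).comp (ContinuousLinearMap.fst ℝ _ _)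

/-- The coordinate one-form `dy^σ`. -/
def dy {n m : ℕ} (r : ℕ) (σ : Fin m) : JetCoord n m r →L[ℝ] ℝ :=
  (EuclideanSpace.proj σ).comp
    ((ContinuousLinearMap.proj (MultiIndex.empty n r)).comp (ContinuousLinearMap.snd ℝ _ _))

/-! ## Fibered manifolds, fibered charts and jets of sections -/

section Fibered

variable (n m : ℕ) {X Y : Type*}
  [TopologicalSpace X] [ChartedSpace (EuclideanSpace ℝ (Fin n)) X]
  [TopologicalSpace Y] [ChartedSpace (EuclideanSpace ℝ (Fin n) × EuclideanSpace ℝ (Fin m)) Y]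

/-- `π : Y → X` is a fibered manifold: a smooth surjective submersion. -/
structure IsFiberedManifold (π : Y → X) : Prop where
  contMDiff : ContMDiff 𝓘(ℝ, EuclideanSpace ℝ (Fin n) × EuclideanSpace ℝ (Fin m))
    𝓘(ℝ, EuclideanSpace ℝ (Fin n)) ∞ π
  surjective : Function.Surjective π
  isSubmersion : Manifold.IsSubmersion
    𝓘(ℝ, EuclideanSpace ℝ (Fin n) × EuclideanSpace ℝ (Fin m)) 𝓘(ℝ, EuclideanSpace ℝ (Fin n)) ∞ π

/-- A fibered chart `(V, ψ)`, `ψ = (x^i, y^σ)`, together with the chart `(π(V), (x^i))` of the base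
over which it lies. -/
structure FiberedChart (π : Y → X) where
  chart : OpenPartialHomeomorph Y (EuclideanSpace ℝ (Fin n) × EuclideanSpace ℝ (Fin m))
  base : OpenPartialHomeomorph X (EuclideanSpace ℝ (Fin n))
  chart_mem : chart ∈ IsManifold.maximalAtlas
    𝓘(ℝ, EuclideanSpace ℝ (Fin n) × EuclideanSpace ℝ (Fin m)) ∞ Y
  base_mem : base ∈ IsManifold.maximalAtlas 𝓘(ℝ, EuclideanSpace ℝ (Fin n)) ∞ X
  base_source : base.source = π '' chart.source
  fst_chart : ∀ y ∈ chart.source, (chart y).1 = base (π y)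

/-- A point of the base with a smooth local section defined on an open neighbourhood of it. -/
structure PointedSection (π : Y → X) where
  pt : X
  dom : Set X
  isOpen_dom : IsOpen dom
  pt_mem : pt ∈ dom
  sec : X → Y
  contMDiffOn : ContMDiffOn 𝓘(ℝ, EuclideanSpace ℝ (Fin n))
    𝓘(ℝ, EuclideanSpace ℝ (Fin n) × EuclideanSpace ℝ (Fin m)) ∞ sec dom
  proj_sec : ∀ x ∈ dom, π (sec x) = x

variable {n m} {π : Y → X}

/-- The coordinates `x^i(x)` and `y^σ_J = ∂_J (y^σ ∘ γ)(x)`, `|J| ≤ r`, of the `r`-jet at `x` of a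
local section `γ`, in a fibered chart around `γ(x)`. -/
def PointedSection.coord (r : ℕ) (c : FiberedChart n m π) (γ : PointedSection n m π) :
    JetCoord n m r :=
  (c.base γ.pt, fun J => iteratedFDeriv ℝ J.toList.length
    (fun u => (c.chart (γ.sec (c.base.symm u))).2) (c.base γ.pt)
    (fun a => EuclideanSpace.single (J.toList.get a) 1))

variable (n m π) in
/-- Two local sections have the same `r`-jet if they are based at the same point, have the same
value there, and the same partial derivatives up to order `r` in the fibered charts around it. -/
def jetSetoid (r : ℕ) : Setoid (PointedSection n m π) where
  r γ δ := γ.pt = δ.pt ∧ γ.sec γ.pt = δ.sec δ.pt ∧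
    ∀ c : FiberedChart n m π, γ.sec γ.pt ∈ c.chart.source → γ.coord r c = δ.coord r c
  iseqv :=
    { refl := fun _ => ⟨rfl, rfl, fun _ _ => rfl⟩
      symm := fun h => ⟨h.1.symm, h.2.1.symm, fun c hc => (h.2.2 c (h.2.1 ▸ hc)).symm⟩
      trans := fun h k => ⟨h.1.trans k.1, h.2.1.trans k.2.1,
        fun c hc => (h.2.2 c hc).trans (k.2.2 c (h.2.1 ▸ hc))⟩ }

variable (n m π) in
/-- The `r`-jet prolongation `J^r Y`, as the set of `r`-jets of local sections. -/
def JetBundle (r : ℕ) : Type _ :=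
  Quotient (jetSetoid n m π r)

/-- The target `γ(x) ∈ Y` of the jet `J^r_x γ`. -/
def JetBundle.target {r : ℕ} (j : JetBundle n m π r) : Y :=
  Quotient.lift (s := jetSetoid n m π r) (fun γ => γ.sec γ.pt) (fun _ _ h => h.2.1) j

open Classical in
/-- The induced fibered chart `ψ^r` of `J^r Y`; it is meaningful on the jets with target in the
domain of `ψ` (and set to `0` on the other ones). -/
def JetBundle.coord {r : ℕ} (c : FiberedChart n m π) (j : JetBundle n m π r) : JetCoord n m r :=
  Quotient.lift (s := jetSetoid n m π r)
    (fun γ => if γ.sec γ.pt ∈ c.chart.source then γ.coord r c else 0)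
    (by
      intro γ δ h
      by_cases hc : γ.sec γ.pt ∈ c.chart.source
      · have hd : δ.sec δ.pt ∈ c.chart.source := h.2.1 ▸ hc
        simp only [hc, hd, if_true]
        exact h.2.2 c hc
      · have hd : δ.sec δ.pt ∉ c.chart.source := h.2.1 ▸ hc
        simp only [hc, hd, if_false]) j

open Classical in
/-- The coordinate transformation `ψ'^r ∘ (ψ^r)⁻¹` between induced charts of `J^r Y`
(set to `0` outside the image of `ψ^r`). -/
def jetTransition (r : ℕ) (c c' : FiberedChart n m π) (z : JetCoord n m r) : JetCoord n m r :=
  if h : ∃ j : JetBundle n m π r, j.target ∈ c.chart.source ∧ j.coord c = z then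
    h.choose.coord c'
  else 0

/-- The image in the chart `ψ^r` of the part of `J^r W` lying over the domain of `ψ`: no condition
on the derivative coordinates `y^σ_J`, `|J| ≥ 1`. -/
def jetDomain (W : Set Y) (r : ℕ) (c : FiberedChart n m π) : Set (JetCoord n m r) :=
  {z | targetCoord z ∈ c.chart.target ∧ c.chart.symm (targetCoord z) ∈ W}

/-! ## Differential forms on jet prolongations -/

variable (n m π) in
/-- Families of coordinate expressions of `k`-forms on `J^r Y`, one for each fibered chart. -/
abbrev CoordForm (r k : ℕ) : Type _ :=
  (c : FiberedChart n m π) → JetCoord n m r → JetCoord n m r [⋀^Fin k]→L[ℝ] ℝ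

variable (n m π) in
/-- The real vector space `Ω_k(W^r)` of smooth differential `k`-forms on `W^r = J^r W`, given by
their smooth coordinate expressions in all fibered charts, which are related by pullback along the
coordinate transformations; they are extended by `0` outside the domain of definition. -/
def Form (W : Set Y) (r k : ℕ) : Submodule ℝ (CoordForm n m π r k) where
  carrier := {ρ |
    (∀ c, ContDiffOn ℝ ∞ (ρ c) (jetDomain W r c)) ∧
    (∀ c, ∀ z ∉ jetDomain W r c, ρ c z = 0) ∧
    ∀ c c', ∀ z ∈ jetDomain W r c, c.chart.symm (targetCoord z) ∈ c'.chart.source →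
      ρ c z = (ρ c' (jetTransition r c c' z)).compContinuousLinearMap
        (fderiv ℝ (jetTransition r c c') z)}
  zero_mem' := ⟨fun _ => contDiffOn_const, fun _ _ _ => rfl, fun _ _ _ _ _ => by ext; simp⟩
  add_mem' := by
    rintro ρ τ ⟨h1, h2, h3⟩ ⟨k1, k2, k3⟩
    refine ⟨fun c => (h1 c).add (k1 c), fun c z hz => ?_, fun c c' z hz hc => ?_⟩
    · simp [h2 c z hz, k2 c z hz]
    · rw [Pi.add_apply, Pi.add_apply, h3 c c' z hz hc, k3 c c' z hz hc]
      ext; simp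
  smul_mem' := by
    rintro a ρ ⟨h1, h2, h3⟩
    refine ⟨fun c => (h1 c).const_smul a, fun c z hz => ?_, fun c c' z hz hc => ?_⟩
    · simp [h2 c z hz]
    · rw [Pi.smul_apply, Pi.smul_apply, h3 c c' z hz hc]
      ext; simp

variable (n m π) in
/-- The real vector space `Ω_{n,X}(W^r)` of Lagrangians of order `r`: the `n`-forms on `W^r`,
`n = dim X`, that are `π^r`-horizontal, i.e. vanish as soon as one argument is `π^r`-vertical. -/
def Lagrangian (W : Set Y) (r : ℕ) : Submodule ℝ (CoordForm n m π r n) where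
  carrier := {ρ | ρ ∈ Form n m π W r n ∧
    ∀ c z (v : Fin n → JetCoord n m r), (∃ i, (v i).1 = 0) → ρ c z v = 0}
  zero_mem' := ⟨Submodule.zero_mem _, fun _ _ _ _ => rfl⟩
  add_mem' := by
    rintro ρ τ ⟨h1, h2⟩ ⟨k1, k2⟩
    exact ⟨Submodule.add_mem _ h1 k1, fun c z v hv => by simp [h2 c z v hv, k2 c z v hv]⟩
  smul_mem' := by
    rintro a ρ ⟨h1, h2⟩
    exact ⟨Submodule.smul_mem _ a h1, fun c z v hv => by simp [h2 c z v hv]⟩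

open Classical in
/-- The exterior derivative of a form on `W^r`, in each fibered chart. -/
def extD (W : Set Y) {r k : ℕ} (ρ : CoordForm n m π r k) : CoordForm n m π r (k + 1) :=
  fun c => (jetDomain W r c).indicator (extDeriv (ρ c))

/-- The pullback of forms by the jet projection `π^{s,r}`. -/
def pull {r s k : ℕ} (h : r ≤ s) (ρ : CoordForm n m π r k) : CoordForm n m π s k :=
  fun c z => (ρ c (jetProj n m h z)).compContinuousLinearMap (jetProj n m h)

/-- The horizontal part `hρ`, of order `r + 1`. -/
def horPart {r k : ℕ} (ρ : CoordForm n m π r k) : CoordForm n m π (r + 1) k :=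
  fun c z => (ρ c (jetProj n m (Nat.le_succ r) z)).compContinuousLinearMap (horMap z)

/-- The 1-contact part `p₁ρ`, of order `r + 1`. -/
def p₁ {r k : ℕ} (ρ : CoordForm n m π r k) : CoordForm n m π (r + 1) k :=
  fun c z => onePart (ρ c (jetProj n m (Nat.le_succ r) z)) (horMap z) (conMap z)

/-- A source form: a 1-contact `(n+1)`-form (it coincides with its 1-contact part, up to pullback)
that is `π^{r,0}`-horizontal (it vanishes as soon as one argument is `π^{r,0}`-vertical). -/
def IsSourceForm {r : ℕ} (ε : CoordForm n m π r (n + 1)) : Prop :=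
  pull (Nat.le_succ r) ε = p₁ ε ∧
  ∀ c z (v : Fin (n + 1) → JetCoord n m r), (∃ i, targetCoord (v i) = 0) → ε c z v = 0

/-- `θ`, of order `s`, is a Lepage equivalent of the Lagrangian `lam`, of order `r`:
`hθ = lam` up to jet projections, and `p₁dθ` is a source form. -/
def IsLepageEquivalent (W : Set Y) {r s : ℕ} (θ : CoordForm n m π s n)
    (lam : CoordForm n m π r n) : Prop :=
  (∀ q, ∀ (hr : r ≤ q) (hs : s + 1 ≤ q), pull hs (horPart θ) = pull hr lam) ∧
  IsSourceForm (p₁ (extD W θ))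

/-- The Lagrange function `L = lam(∂/∂x¹, …, ∂/∂xⁿ)` of a Lagrangian in a fibered chart, so that
`lam = L dx¹ ∧ … ∧ dxⁿ`. -/
def lagrangeFun {r : ℕ} (lam : CoordForm n m π r n) (c : FiberedChart n m π) :
    JetCoord n m r → ℝ :=
  fun z => lam c z fun i => (EuclideanSpace.single i 1, 0)

open Classical in
/-- The Euler–Lagrange form of a Lagrangian of order `r`, on `W^{2r}`, in each fibered chart:
`E_σ ω^σ ∧ ω₀ = E_σ dy^σ ∧ dx¹ ∧ … ∧ dxⁿ` (since `ω^σ = dy^σ - y^σ_j dx^j` and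
`dx^j ∧ ω₀ = 0`). -/
def eulerForm (W : Set Y) {r : ℕ} (lam : CoordForm n m π r n) :
    CoordForm n m π (2 * r) (n + 1) :=
  fun c => (jetDomain W (2 * r) c).indicator fun z =>
    ∑ σ : Fin m, eulerExpr (lagrangeFun lam c) σ z •
      wedge (Fin.cons (dy (2 * r) σ) (dx (2 * r)))

/-- A Lagrangian is trivial if its Euler–Lagrange form vanishes identically. -/
def IsTrivial (W : Set Y) {r : ℕ} (lam : CoordForm n m π r n) : Prop :=
  eulerForm W lam = 0

/-- Two Lagrangians are dynamically equivalent if they have the same Euler–Lagrange form. -/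
def DynamicallyEquivalent (W : Set Y) {r : ℕ} (lam lam' : CoordForm n m π r n) : Prop :=
  eulerForm W lam = eulerForm W lam'

/-- The closure property of a mapping `lam ↦ θ lam`: `dθ_lam = 0` for trivial `lam`. -/
def HasClosureProperty {W : Set Y} {r s : ℕ}
    (θ : Lagrangian n m π W r → Form n m π W s n) : Prop :=
  ∀ lam : Lagrangian n m π W r,
    IsTrivial W (lam : CoordForm n m π r n) → extD W (θ lam : CoordForm n m π s n) = 0

end Fibered

end Lepage

end

open scoped Manifold ContDiff

noncomputable section

namespace Lepage

/-! The argument is linear algebra. The Euler–Lagrange form depends linearly on the Lagrangian, so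
dynamically equivalent Lagrangians differ by a trivial one, and the closure property makes the
Lepage equivalent of that difference closed. Since `θ` and the exterior derivative are additive,
this closed form has differential `dθ_lam - dθ_lam'`. The work lies in the two subtraction rules
`eulerForm_sub` and `extD_sub`. Coordinate expressions are total functions known to be smooth only
on `jetDomain`, and `fderiv` respects differences only at points of differentiability. Smoothness on
these open sets is therefore carried through every total derivative. -/

/-! ### Smoothness on jet domains -/

theorem contDiff_targetCoord {n m r : ℕ} :
    ContDiff ℝ ∞ (targetCoord : JetCoord n m r → _) :=
  contDiff_fst.prodMk ((contDiff_apply ℝ _ _).comp contDiff_snd)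

theorem contDiff_totalVec {n m r : ℕ} (i : Fin n) :
    ContDiff ℝ ∞ fun z : JetCoord n m (r + 1) => totalVec z i :=
  contDiff_const.prodMk (contDiff_pi.2 fun J => (contDiff_apply ℝ _ (J.cons i)).comp contDiff_snd)

section Fibered

variable {n m : ℕ} {X Y : Type*}
  [TopologicalSpace X] [ChartedSpace (EuclideanSpace ℝ (Fin n)) X]
  [TopologicalSpace Y] [ChartedSpace (EuclideanSpace ℝ (Fin n) × EuclideanSpace ℝ (Fin m)) Y]
  {π : Y → X} {W : Set Y} {c : FiberedChart n m π}

/-- Membership constrains only the target coordinates, so this is the preimage under `targetCoord`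
of an open set. Openness is what makes derivatives at its points independent of values outside it.
-/
theorem isOpen_jetDomain (hW : IsOpen W) (r : ℕ) (c : FiberedChart n m π) :
    IsOpen (jetDomain W r c) :=
  (c.chart.isOpen_inter_preimage_symm hW).preimage contDiff_targetCoord.continuous

theorem jetProj_mem_jetDomain {r s : ℕ} (h : r ≤ s) {z : JetCoord n m s}
    (hz : z ∈ jetDomain W s c) : jetProj n m h z ∈ jetDomain W r c :=
  -- Jet projections leave `(x^i, y^σ)` unchanged, so both membership conditions agree
  -- definitionally.
  hz

theorem contDiffOn_totalDeriv (hW : IsOpen W) {r : ℕ} {f : JetCoord n m r → ℝ}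
    (hf : ContDiffOn ℝ ∞ f (jetDomain W r c)) (i : Fin n) :
    ContDiffOn ℝ ∞ (totalDeriv i f) (jetDomain W (r + 1) c) :=
  ((hf.fderiv_of_isOpen (isOpen_jetDomain hW r c) (by simp)).comp
    (jetProj n m (Nat.le_succ r)).contDiff.contDiffOn
    (fun _ hz => jetProj_mem_jetDomain _ hz)).clm_apply (contDiff_totalVec i).contDiffOn

theorem contDiffOn_iterTotalDeriv (hW : IsOpen W) {r : ℕ} {f : JetCoord n m r → ℝ}
    (hf : ContDiffOn ℝ ∞ f (jetDomain W r c)) (l : List (Fin n)) :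
    ContDiffOn ℝ ∞ (iterTotalDeriv f l) (jetDomain W (r + l.length) c) := by
  induction l with
  | nil => exact hf
  | cons i l ih => exact contDiffOn_totalDeriv hW ih i

/-! ### Linearity of the Euler–Lagrange form -/

/-- On an open set, the derivative is determined by the values, and is subtractive on smooth
functions. -/
theorem fderiv_eq_sub_of_eqOn {E : Type*} [NormedAddCommGroup E] [NormedSpace ℝ E] {U : Set E}
    (hU : IsOpen U) {f g h : E → ℝ} (hf : ContDiffOn ℝ ∞ f U) (hg : ContDiffOn ℝ ∞ g U)
    (hh : Set.EqOn h (f - g) U) {z : E} (hz : z ∈ U) :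
    fderiv ℝ h z = fderiv ℝ f z - fderiv ℝ g z := by
  have hzU := hU.mem_nhds hz
  rw [(hh.eventuallyEq_of_mem hzU).fderiv_eq]
  exact fderiv_sub ((hf.contDiffAt hzU).differentiableAt (by simp))
    ((hg.contDiffAt hzU).differentiableAt (by simp))

/-- The third function `h`, agreeing with `f - g` only on the domain, is needed twice: the induction
step yields agreement only there, and so do the partial derivatives to which this is applied in
`eulerExpr_sub`. -/
theorem iterTotalDeriv_eqOn_sub (hW : IsOpen W) {r : ℕ} {f g h : JetCoord n m r → ℝ}
    (hf : ContDiffOn ℝ ∞ f (jetDomain W r c)) (hg : ContDiffOn ℝ ∞ g (jetDomain W r c))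
    (hh : Set.EqOn h (f - g) (jetDomain W r c)) (l : List (Fin n)) :
    Set.EqOn (iterTotalDeriv h l) (iterTotalDeriv f l - iterTotalDeriv g l)
      (jetDomain W (r + l.length) c) := by
  induction l with
  | nil => exact hh
  | cons i l ih =>
    intro z hz
    simp only [Pi.sub_apply, iterTotalDeriv, totalDeriv]
    rw [fderiv_eq_sub_of_eqOn (isOpen_jetDomain hW _ c) (contDiffOn_iterTotalDeriv hW hf l)
      (contDiffOn_iterTotalDeriv hW hg l) ih (jetProj_mem_jetDomain _ hz)]
    rfl

theorem contDiffOn_partialY (hW : IsOpen W) {r : ℕ} {f : JetCoord n m r → ℝ}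
    (hf : ContDiffOn ℝ ∞ f (jetDomain W r c)) (σ : Fin m) (J : MultiIndex n r) :
    ContDiffOn ℝ ∞ (partialY σ J f) (jetDomain W r c) :=
  (hf.fderiv_of_isOpen (isOpen_jetDomain hW r c) (by simp)).clm_apply contDiffOn_const

theorem eulerExpr_sub (hW : IsOpen W) {r : ℕ} {f g : JetCoord n m r → ℝ}
    (hf : ContDiffOn ℝ ∞ f (jetDomain W r c)) (hg : ContDiffOn ℝ ∞ g (jetDomain W r c))
    (σ : Fin m) {z : JetCoord n m (2 * r)} (hz : z ∈ jetDomain W (2 * r) c) :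
    eulerExpr (f - g) σ z = eulerExpr f σ z - eulerExpr g σ z := by
  simp only [eulerExpr]
  rw [← Finset.sum_sub_distrib]
  refine Finset.sum_congr rfl fun J _ => ?_
  have hpartial : Set.EqOn (partialY σ J (f - g)) (partialY σ J f - partialY σ J g)
      (jetDomain W r c) := fun w hw => by
    simp only [Pi.sub_apply, partialY]
    rw [fderiv_eq_sub_of_eqOn (isOpen_jetDomain hW r c) hf hg (Set.eqOn_refl _ _) hw]
    rfl
  rw [← mul_sub]
  congr 1
  -- The `J` term has order `r + |J| ≤ 2 * r` and is evaluated at a projection of `z`, which stays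
  -- in the jet domain.
  exact iterTotalDeriv_eqOn_sub hW (contDiffOn_partialY hW hf σ J) (contDiffOn_partialY hW hg σ J)
    hpartial J.toList (jetProj_mem_jetDomain _ hz)

/-- Evaluation of alternating forms at fixed vectors is continuous linear, hence preserves
smoothness. -/
theorem contDiffOn_lagrangeFun {r : ℕ} {lam : CoordForm n m π r n} (hlam : lam ∈ Form n m π W r n)
    (c : FiberedChart n m π) : ContDiffOn ℝ ∞ (lagrangeFun lam c) (jetDomain W r c) :=
  (ContinuousAlternatingMap.apply ℝ (JetCoord n m r) ℝ
    fun i : Fin n => (EuclideanSpace.single i 1, 0)).contDiff.comp_contDiffOn (hlam.1 c)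

theorem eulerForm_sub (hW : IsOpen W) {r : ℕ} {lam lam' : CoordForm n m π r n}
    (hlam : lam ∈ Form n m π W r n) (hlam' : lam' ∈ Form n m π W r n) :
    eulerForm W (lam - lam') = eulerForm W lam - eulerForm W lam' := by
  funext c z
  by_cases hz : z ∈ jetDomain W (2 * r) c
  · simp only [eulerForm, Pi.sub_apply, Set.indicator_of_mem hz]
    rw [← Finset.sum_sub_distrib]
    refine Finset.sum_congr rfl fun σ _ => ?_
    -- The Lagrange function of a difference is definitionally the difference of the Lagrange
    -- functions.
    have hsub : eulerExpr (lagrangeFun (lam - lam') c) σ z =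
        eulerExpr (lagrangeFun lam c) σ z - eulerExpr (lagrangeFun lam' c) σ z :=
      eulerExpr_sub hW (contDiffOn_lagrangeFun hlam c) (contDiffOn_lagrangeFun hlam' c) σ hz
    ext v
    simp [hsub, sub_mul]
  · simp [eulerForm, Set.indicator_of_notMem hz]

/-! ### Linearity of the exterior derivative -/

theorem extD_sub (hW : IsOpen W) {r k : ℕ} {ρ τ : CoordForm n m π r k}
    (hρ : ρ ∈ Form n m π W r k) (hτ : τ ∈ Form n m π W r k) :
    extD W (ρ - τ) = extD W ρ - extD W τ := by
  funext c z
  by_cases hz : z ∈ jetDomain W r c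
  · have hzU := (isOpen_jetDomain hW r c).mem_nhds hz
    simp only [extD, Pi.sub_apply, Set.indicator_of_mem hz]
    have hρd := ((hρ.1 c).contDiffAt hzU).differentiableAt (by simp)
    have hτd := ((hτ.1 c).contDiffAt hzU).differentiableAt (by simp)
    -- The difference rule is the sum rule applied to `(ρ - τ) + τ = ρ`.
    rw [eq_sub_iff_add_eq, ← extDeriv_add (hρd.sub hτd) hτd, sub_add_cancel]
  · simp [extD, Set.indicator_of_notMem hz]

end Fibered

end Lepage

end

/-! ### Closure property applied to the difference of the Lagrangians -/

theorem mainTheorem7 {n m : ℕ} {X Y : Type*}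
    [TopologicalSpace X] [ChartedSpace (EuclideanSpace ℝ (Fin n)) X]
    [IsManifold 𝓘(ℝ, EuclideanSpace ℝ (Fin n)) ∞ X]
    [TopologicalSpace Y] [ChartedSpace (EuclideanSpace ℝ (Fin n) × EuclideanSpace ℝ (Fin m)) Y]
    [IsManifold 𝓘(ℝ, EuclideanSpace ℝ (Fin n) × EuclideanSpace ℝ (Fin m)) ∞ Y]
    (π : Y → X) (hπ : Lepage.IsFiberedManifold n m π) (W : Set Y) (hW : IsOpen W) (r s : ℕ)
    (θ : Lepage.Lagrangian n m π W r → Lepage.Form n m π W s n)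
    (hLepage : ∀ lam, Lepage.IsLepageEquivalent W
      (θ lam : Lepage.CoordForm n m π s n) (lam : Lepage.CoordForm n m π r n))
    (hlinear : IsLinearMap ℝ θ) (hclosure : Lepage.HasClosureProperty θ)
    (lam lam' : Lepage.Lagrangian n m π W r)
    (hequiv : Lepage.DynamicallyEquivalent W
      (lam : Lepage.CoordForm n m π r n) (lam' : Lepage.CoordForm n m π r n)) :
    Lepage.extD W (θ lam : Lepage.CoordForm n m π s n) =
      Lepage.extD W (θ lam' : Lepage.CoordForm n m π s n) := by
  have htrivial : Lepage.IsTrivial W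
      ((lam - lam' : Lepage.Lagrangian n m π W r) : Lepage.CoordForm n m π r n) := by
    rw [Lepage.IsTrivial, Submodule.coe_sub, Lepage.eulerForm_sub hW lam.2.1 lam'.2.1]
    exact sub_eq_zero.2 hequiv
  have hclosed := hclosure _ htrivial
  -- Additivity of `θ` on `(lam - lam') + lam' = lam` gives its compatibility with differences.
  have hsub : (θ (lam - lam') : Lepage.CoordForm n m π s n) = θ lam - θ lam' := by
    have hcancel : lam - lam' + lam' = lam := Subtype.ext (sub_add_cancel lam.1 lam'.1)
    have hadd : (θ (lam - lam' + lam') : Lepage.CoordForm n m π s n) =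
        θ (lam - lam') + θ lam' := congrArg Subtype.val (hlinear.map_add (lam - lam') lam')
    rw [hcancel] at hadd
    exact eq_sub_of_add_eq hadd.symm
  rw [hsub, Lepage.extD_sub hW (θ lam).2 (θ lam').2] at hclosed
  exact sub_eq_zero.1 hclosed
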